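/- For $n\ge 1$ let $p_n$ denote the $n$-th prime ($p_1=2$), and for real $x$ let $\theta(x)=\sum_{p\le x}\log p$, the sum being over the primes $p\le x$, so that $\theta(p_n)=\sum_{k=1}^{n}\log p_k$. Then $\theta(p_n)\sim p_n$ as $n\to\infty$, that is, $$\lim_{n\to\infty}\frac{\theta(p_n)}{p_n}=1 .$$ -/

import Mathlib

/-- The `n`-th prime in the usual numbering from one: `nthPrime 1 = 2`, `nthPrime 2 = 3`, and so on
(`Nat.nth` counts from zero). The value at `n = 0` is immaterial. -/
noncomputable def nthPrime (n : ℕ) : ℕ :=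
  Nat.nth Nat.Prime (n - 1)

/-! Newman–Ikehara style: `ψ(e^t) e^(-t) - 1` is bounded by Chebyshev's estimate, and its Laplace
transform extends continuously to `0 ≤ Re s`, because `ζ` has no zeros on `Re s = 1` and subtracting
1 cancels the pole. Averaging against a Fejér kernel, whose Fourier transform has compact support,
involves only a bounded segment of the boundary values, so Riemann–Lebesgue sends the averages to 0
(`tendsto_integral_mul_fejerKernel_of_laplace`). As `ψ` is monotone, averages over short windows
control point values (`tendsto_one_of_laplace`), so `ψ(x) ~ x`. Since `ψ - θ = O(√x)`, also `θ(x) ~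
x`; now let `x` run through the primes. -/

open MeasureTheory Filter Topology Set

/-! ### The Fejér kernel -/

/-- The Fejér kernel on the real line, as the cosine transform of a triangle. -/
noncomputable def fejerKernel (u : ℝ) : ℝ :=
  ∫ w in (0 : ℝ)..1, 2 * (1 - w) * Real.cos (w * u)

lemma continuous_fejerKernel : Continuous fejerKernel := by
  unfold fejerKernel
  refine intervalIntegral.continuous_parametric_intervalIntegral_of_continuous
    (f := fun u w ↦ 2 * (1 - w) * Real.cos (w * u)) ?_ continuous_const
  unfold Function.uncurry
  fun_prop

lemma fejerKernel_zero : fejerKernel 0 = 1 := by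
  have h (x : ℝ) : HasDerivAt (fun w : ℝ ↦ 2 * w - w ^ 2) (2 * (1 - x) * Real.cos (x * 0)) x := by
    have := ((hasDerivAt_id x).const_mul 2).sub ((hasDerivAt_id x).pow 2)
    convert! this using 1
    simp
    ring
  rw [fejerKernel, intervalIntegral.integral_eq_sub_of_hasDerivAt (fun x _ ↦ h x)
    (Continuous.intervalIntegrable (by fun_prop) _ _)]
  norm_num

/-- The integral form serves Fubini and continuity; this closed form gives the sign and the decay.
-/
lemma fejerKernel_eq {u : ℝ} (hu : u ≠ 0) : fejerKernel u = 2 * (1 - Real.cos u) / u ^ 2 := by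
  have h (x : ℝ) : HasDerivAt
      (fun w : ℝ ↦ 2 * (1 - w) * (Real.sin (w * u) / u) - 2 * Real.cos (w * u) / u ^ 2)
      (2 * (1 - x) * Real.cos (x * u)) x := by
    have h₁ : HasDerivAt (fun w : ℝ ↦ w * u) u x := by
      simpa using (hasDerivAt_id x).mul_const u
    have h₂ : HasDerivAt (fun w : ℝ ↦ 2 * (1 - w)) (-2) x := by
      simpa using ((hasDerivAt_id x).const_sub 1).const_mul 2
    have := (h₂.mul (h₁.sin.div_const u)).sub ((h₁.cos.const_mul 2).div_const (u ^ 2))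
    convert! this using 1
    field_simp
    ring
  rw [fejerKernel, intervalIntegral.integral_eq_sub_of_hasDerivAt (fun x _ ↦ h x)
    (Continuous.intervalIntegrable (by fun_prop) _ _)]
  simp
  field_simp
  ring

lemma fejerKernel_nonneg (u : ℝ) : 0 ≤ fejerKernel u := by
  rcases eq_or_ne u 0 with rfl | hu
  · simp [fejerKernel_zero]
  · rw [fejerKernel_eq hu]
    have := Real.cos_le_one u
    exact div_nonneg (by linarith) (sq_nonneg u)

lemma fejerKernel_le (u : ℝ) : fejerKernel u ≤ 8 * (1 + u ^ 2)⁻¹ := by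
  rcases eq_or_ne u 0 with rfl | hu
  · norm_num [fejerKernel_zero]
  · rw [fejerKernel_eq hu, ← div_eq_mul_inv, div_le_div_iff₀ (by positivity) (by positivity)]
    -- The first bound is for small `u`, the second for large `u`; together they would give even 5
    -- in place of 8.
    have h₁ := Real.one_sub_sq_div_two_le_cos (x := u)
    have h₂ := Real.neg_one_le_cos u
    nlinarith [sq_nonneg u]

lemma integrable_fejerKernel : Integrable fejerKernel :=
  (integrable_inv_one_add_sq.const_mul 8).mono' continuous_fejerKernel.aestronglyMeasurable <|
    .of_forall fun u ↦ by
      rw [Real.norm_of_nonneg (fejerKernel_nonneg u)]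
      exact fejerKernel_le u

/-- The exact value of the integral is never needed: it cancels in the Tauberian argument. -/
lemma integral_fejerKernel_pos : 0 < ∫ u, fejerKernel u := by
  rw [integral_pos_iff_support_of_nonneg fejerKernel_nonneg integrable_fejerKernel]
  exact continuous_fejerKernel.isOpen_support.measure_pos _ ⟨0, by simp [fejerKernel_zero]⟩

/-! ### Fejér averages and boundary values of the Laplace transform -/

/-- Fubini's theorem for the damped convolution of a bounded function with the Fejér kernel. -/
lemma integral_mul_fejerKernel {a : ℝ → ℝ} {C : ℝ} (ha : Measurable a) (hC : ∀ t, |a t| ≤ C)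
    {σ : ℝ} (hσ : 0 < σ) (c y : ℝ) :
    ∫ t in Ioi 0, a t * Real.exp (-σ * t) * fejerKernel (c * (y - t)) =
      (∫ w in (0 : ℝ)..1, 2 * (1 - w) * Complex.exp (Complex.I * (c * y * w)) *
        ∫ t in Ioi (0 : ℝ), (a t : ℂ) * Complex.exp (-(σ + Complex.I * (c * w)) * t)).re := by
  -- With an exponential in place of the cosine, the integral over `t` becomes a Laplace transform
  -- at `σ + icw`.
  let F : ℝ → ℝ → ℂ := fun t w ↦ ((a t * Real.exp (-σ * t) : ℝ) : ℂ) *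
    (2 * (1 - w) * Complex.exp ((w * (c * (y - t)) : ℝ) * Complex.I))
  -- Since `a` is only bounded, the damping factor is what makes Fubini applicable.
  have hexp : Integrable (fun t : ℝ ↦ a t * Real.exp (-σ * t)) (volume.restrict (Ioi 0)) :=
    (exp_neg_integrableOn_Ioi 0 hσ).bdd_mul ha.aestronglyMeasurable (.of_forall hC)
  have hFm : Measurable (Function.uncurry F) := by
    have : Measurable fun p : ℝ × ℝ ↦ a p.1 := ha.comp measurable_fst
    unfold Function.uncurry
    simp only [F]
    fun_prop
  have hF : Integrable (Function.uncurry F)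
      ((volume.restrict (Ioi 0)).prod (volume.restrict (Ioc 0 1))) := by
    refine (hexp.norm.mul_const 2 |>.comp_fst (volume.restrict (Ioc (0 : ℝ) 1))).mono'
      hFm.aestronglyMeasurable ?_
    have : ∀ᵐ p : ℝ × ℝ ∂(volume.restrict (Ioi 0)).prod (volume.restrict (Ioc 0 1)),
        p ∈ Ioi (0 : ℝ) ×ˢ Ioc (0 : ℝ) 1 := by
      rw [Measure.prod_restrict]
      exact ae_restrict_mem (measurableSet_Ioi.prod measurableSet_Ioc)
    filter_upwards [this] with p hp
    simp only [Function.uncurry, F, norm_mul, Complex.norm_real, Complex.norm_exp_ofReal_mul_I,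
      mul_one]
    have h1 : ‖(1 - p.2 : ℂ)‖ ≤ 1 := by
      rw [← Complex.ofReal_one, ← Complex.ofReal_sub, Complex.norm_real, Real.norm_eq_abs,
        abs_le]
      constructor <;> linarith [hp.2.1, hp.2.2]
    gcongr
    norm_num
    linarith
  have hswap := integral_integral_swap hF
  have hin (t : ℝ) : (∫ w in Ioc (0 : ℝ) 1, F t w).re =
      a t * Real.exp (-σ * t) * fejerKernel (c * (y - t)) := by
    have hi : Integrable (fun w : ℝ ↦ (2 * (1 - w) *
        Complex.exp ((w * (c * (y - t)) : ℝ) * Complex.I) : ℂ)) (volume.restrict (Ioc 0 1)) :=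
      (Continuous.intervalIntegrable (by fun_prop) 0 1).1
    simp only [F]
    rw [integral_const_mul, Complex.re_ofReal_mul]
    congr 1
    rw [fejerKernel, intervalIntegral.integral_of_le zero_le_one]
    refine (integral_re hi).symm.trans (integral_congr_ae (.of_forall fun w ↦ ?_))
    have : (2 * (1 - w) : ℂ) = ((2 * (1 - w) : ℝ) : ℂ) := by push_cast; ring
    simp only [RCLike.re_to_complex]
    rw [this, Complex.re_ofReal_mul, Complex.exp_ofReal_mul_I_re]
  rw [intervalIntegral.integral_of_le zero_le_one]
  trans (∫ t in Ioi (0 : ℝ), ∫ w in Ioc (0 : ℝ) 1, F t w).re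
  · refine Eq.trans ?_ (integral_re hF.integral_prod_left)
    exact integral_congr_ae (.of_forall fun t ↦ (hin t).symm)
  · rw [hswap]
    congr 1
    refine integral_congr_ae (.of_forall fun w ↦ ?_)
    simp only
    rw [← integral_const_mul]
    refine integral_congr_ae (.of_forall fun t ↦ ?_)
    simp only [F]
    push_cast
    have : Complex.exp (-(σ + Complex.I * (c * w)) * t) * Complex.exp (Complex.I * (c * y * w)) =
        Complex.exp (-σ * t) * Complex.exp (w * (c * (y - t)) * Complex.I) := by
      rw [← Complex.exp_add, ← Complex.exp_add]
      congr 1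
      ring
    linear_combination (-2 * (1 - w) * a t : ℂ) * this

/-- If the Laplace transform of a bounded function extends continuously to the closed right
half-plane, then the convolution with the Fejér kernel is a Fourier coefficient of the boundary
values. -/
lemma integral_mul_fejerKernel_eq_of_laplace {a : ℝ → ℝ} {C : ℝ} {G : ℂ → ℂ} (ha : Measurable a)
    (hC : ∀ t, |a t| ≤ C) (hG : ContinuousOn G {s | 0 ≤ s.re})
    (hL : ∀ s : ℂ, 0 < s.re → ∫ t in Ioi (0 : ℝ), (a t : ℂ) * Complex.exp (-s * t) = G s)
    {c : ℝ} (hc : 0 < c) (y : ℝ) :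
    ∫ t in Ioi 0, a t * fejerKernel (c * (y - t)) =
      (∫ w in (0 : ℝ)..1, 2 * (1 - w) * Complex.exp (Complex.I * (c * y * w)) *
        G (Complex.I * (c * w))).re := by
  have hK : Integrable (fun t ↦ fejerKernel (c * (y - t))) :=
    (integrable_fejerKernel.comp_mul_left' hc.ne').comp_sub_left y
  have hlim₁ : Tendsto
      (fun σ : ℝ ↦ ∫ t in Ioi 0, a t * Real.exp (-σ * t) * fejerKernel (c * (y - t)))
      (𝓝[>] 0) (𝓝 (∫ t in Ioi 0, a t * fejerKernel (c * (y - t)))) := by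
    refine tendsto_integral_filter_of_dominated_convergence
      (fun t ↦ C * fejerKernel (c * (y - t))) ?_ ?_ (hK.const_mul C).restrict ?_
    · refine .of_forall fun σ ↦ Measurable.aestronglyMeasurable ?_
      have := continuous_fejerKernel.measurable
      fun_prop
    · filter_upwards [self_mem_nhdsWithin] with σ hσ
      filter_upwards [ae_restrict_mem measurableSet_Ioi] with t ht
      rw [norm_mul, norm_mul, Real.norm_of_nonneg (fejerKernel_nonneg _),
        Real.norm_of_nonneg (Real.exp_nonneg _)]
      have h₁ : Real.exp (-σ * t) ≤ 1 := by
        rw [Real.exp_le_one_iff]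
        have := mul_pos (mem_Ioi.mp hσ) (mem_Ioi.mp ht)
        linarith
      refine mul_le_mul_of_nonneg_right ?_ (fejerKernel_nonneg _)
      calc _ ≤ |a t| * 1 := mul_le_mul_of_nonneg_left h₁ (abs_nonneg _)
        _ ≤ C := by simpa using hC t
    · refine .of_forall fun t ↦ ?_
      have : Continuous fun σ : ℝ ↦ a t * Real.exp (-σ * t) * fejerKernel (c * (y - t)) := by
        fun_prop
      simpa using (this.tendsto 0).mono_left (nhdsWithin_le_nhds (s := Ioi 0))
  -- `G` is controlled only for `0 ≤ Re s`; `|σ|` makes the integrand continuous for all real `σ`.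
  have hGc : Continuous fun p : ℝ × ℝ ↦ G (|p.1| + Complex.I * (c * p.2)) :=
    hG.comp_continuous (by fun_prop) fun p ↦ by simp
  have hcont : Continuous fun σ : ℝ ↦ (∫ w in (0 : ℝ)..1, 2 * (1 - w) *
      Complex.exp (Complex.I * (c * y * w)) * G (|σ| + Complex.I * (c * w))).re := by
    refine Complex.continuous_re.comp ?_
    refine intervalIntegral.continuous_parametric_intervalIntegral_of_continuous
      (f := fun (σ w : ℝ) ↦ 2 * (1 - w) *
        Complex.exp (Complex.I * (c * y * w)) * G (|σ| + Complex.I * (c * w))) ?_ continuous_const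
    exact Continuous.mul (by fun_prop) hGc
  have hlim₂ := (hcont.tendsto 0).mono_left (nhdsWithin_le_nhds (s := Ioi 0))
  simp only [abs_zero, Complex.ofReal_zero, zero_add] at hlim₂
  refine tendsto_nhds_unique hlim₁ (hlim₂.congr' ?_)
  filter_upwards [self_mem_nhdsWithin] with σ hσ
  have hσ' : 0 < σ := hσ
  rw [integral_mul_fejerKernel ha hC hσ', abs_of_pos hσ']
  congr 1
  refine intervalIntegral.integral_congr fun w _ ↦ ?_
  rw [hL _ (by simpa using hσ')]

/-- Riemann–Lebesgue applied to the boundary values of `G` cut off by the triangle `2(1 - w)` on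
`(0, 1]`. -/
lemma tendsto_integral_mul_fejerKernel_of_laplace {a : ℝ → ℝ} {C : ℝ} {G : ℂ → ℂ}
    (ha : Measurable a) (hC : ∀ t, |a t| ≤ C) (hG : ContinuousOn G {s | 0 ≤ s.re})
    (hL : ∀ s : ℂ, 0 < s.re → ∫ t in Ioi (0 : ℝ), (a t : ℂ) * Complex.exp (-s * t) = G s)
    {c : ℝ} (hc : 0 < c) :
    Tendsto (fun y ↦ ∫ t in Ioi 0, a t * fejerKernel (c * (y - t))) atTop (𝓝 0) := by
  simp_rw [integral_mul_fejerKernel_eq_of_laplace ha hC hG hL hc]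
  have hRL := Real.tendsto_integral_exp_smul_cocompact
    ((Ioc (0 : ℝ) 1).indicator fun w ↦ 2 * (1 - w) * G (Complex.I * (c * w)))
  -- The Fourier character is `exp(2πi ·)`, whence the factor `2π` in the frequency.
  have hy : Tendsto (fun y : ℝ ↦ -(c / (2 * Real.pi)) * y) atTop (cocompact ℝ) :=
    ((tendsto_const_mul_atBot_of_neg (by have := Real.pi_pos; simp; positivity)).mpr
      tendsto_id).mono_right atBot_le_cocompact
  have := (Complex.continuous_re.tendsto 0).comp (hRL.comp hy)
  rw [Complex.zero_re] at this
  refine this.congr fun y ↦ ?_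
  simp only [Function.comp_apply]
  rw [intervalIntegral.integral_of_le zero_le_one, ← integral_indicator measurableSet_Ioc]
  congr 2
  funext w
  by_cases hw : w ∈ Ioc (0 : ℝ) 1
  · simp only [indicator_of_mem hw, Circle.smul_def, Real.fourierChar_apply, smul_eq_mul]
    have : ((2 * Real.pi * -(w * (-(c / (2 * Real.pi)) * y)) : ℝ) : ℂ) * Complex.I =
        Complex.I * (c * y * w) := by
      push_cast
      have : (Real.pi : ℂ) ≠ 0 := by simp [Real.pi_ne_zero]
      field_simp
    rw [this]
    ring
  · simp [indicator_of_notMem hw]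

/-! ### The Tauberian theorem -/

/-- A form of the Wiener–Ikehara theorem for functions already known to be bounded. -/
theorem tendsto_one_of_laplace {b : ℝ → ℝ} {C : ℝ} {G : ℂ → ℂ} (hb : Measurable b)
    (hb₀ : ∀ t ≤ 0, b t = 0) (hnn : ∀ t, 0 ≤ b t) (hC : ∀ t, b t ≤ C)
    (hmono : Monotone fun t ↦ b t * Real.exp t) (hG : ContinuousOn G {s | 0 ≤ s.re})
    (hL : ∀ s : ℂ, 0 < s.re →
      ∫ t in Ioi (0 : ℝ), ((b t - 1 : ℝ) : ℂ) * Complex.exp (-s * t) = G s) :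
    Tendsto b atTop (𝓝 1) := by
  set I := ∫ u, fejerKernel u with hI
  have hI₀ : 0 < I := integral_fejerKernel_pos
  have hC₀ : 0 ≤ C := (hnn 0).trans (hC 0)
  have hint (c y : ℝ) : Integrable fun v ↦ b (y - v / c) * fejerKernel v :=
    integrable_fejerKernel.bdd_mul (c := C) (Measurable.aestronglyMeasurable (by fun_prop)) <| .of_forall fun v ↦ by
      rw [Real.norm_of_nonneg (hnn _)]; exact hC _
  -- The substitution `v = c(y - t)` fixes the kernel; the vanishing of `b` on `t ≤ 0` extends the
  -- integral to the whole line.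
  have hconv {c : ℝ} (hc : 0 < c) :
      Tendsto (fun y ↦ ∫ v, b (y - v / c) * fejerKernel v) atTop (𝓝 I) := by
    have hK (y : ℝ) : Integrable fun t ↦ fejerKernel (c * (y - t)) :=
      (integrable_fejerKernel.comp_mul_left' hc.ne').comp_sub_left y
    have hbK (y : ℝ) : Integrable fun t ↦ b t * fejerKernel (c * (y - t)) :=
      (hK y).bdd_mul (c := C) hb.aestronglyMeasurable <| .of_forall fun v ↦ by
        rw [Real.norm_of_nonneg (hnn _)]; exact hC _
    have h₁ := tendsto_integral_mul_fejerKernel_of_laplace (C := C + 1) (hb.sub_const 1)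
      (fun t ↦ abs_le.mpr ⟨by linarith [hnn t], by linarith [hC t]⟩) hG hL hc
    have h₂ : Tendsto (fun y ↦ ∫ t in Ioi 0, fejerKernel (c * (y - t))) atTop (𝓝 (c⁻¹ * I)) := by
      have key (y : ℝ) : ∫ t in Ioi 0, fejerKernel (c * (y - t)) =
          ∫ u in Iio y, fejerKernel (c * u) := by
        have h := integral_sub_left_eq_self ((Iio y).indicator fun u ↦ fejerKernel (c * u))
          volume y
        rw [integral_indicator measurableSet_Iio] at h
        rw [← h, ← integral_indicator measurableSet_Ioi]
        congr 1
        funext t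
        simp [indicator_apply]
      simp_rw [key]
      have hcov := (aecover_Iio (μ := volume) tendsto_id (l := (atTop : Filter ℝ)))
      have := hcov.integral_tendsto_of_countably_generated
        (integrable_fejerKernel.comp_mul_left' hc.ne')
      rw [Measure.integral_comp_mul_left, abs_of_pos (inv_pos.mpr hc), smul_eq_mul] at this
      exact this
    have h₃ := (h₁.add h₂).const_mul c
    rw [zero_add, mul_inv_cancel_left₀ hc.ne'] at h₃
    refine h₃.congr fun y ↦ ?_
    rw [← integral_add ?_ (hK y).restrict]
    · have e₁ : ∫ t in Ioi 0, ((b t - 1) * fejerKernel (c * (y - t)) + fejerKernel (c * (y - t)))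
          = ∫ t, b t * fejerKernel (c * (y - t)) := by
        rw [← setIntegral_eq_integral_of_forall_compl_eq_zero (s := Ioi 0)
          (f := fun t ↦ b t * fejerKernel (c * (y - t)))]
        · congr 1
          funext t
          ring
        · intro t ht
          rw [hb₀ t (by simpa using ht), zero_mul]
      rw [e₁, ← integral_sub_left_eq_self _ volume y]
      have := Measure.integral_comp_mul_left (fun v ↦ b (y - v / c) * fejerKernel v) c
      rw [abs_of_pos (inv_pos.mpr hc), smul_eq_mul] at this
      rw [eq_comm, ← mul_right_inj' (inv_ne_zero hc.ne'), ← this, inv_mul_cancel_left₀ hc.ne']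
      congr 1
      funext t
      rw [mul_div_cancel_left₀ _ hc.ne', sub_sub_cancel]
    · refine ((hbK y).sub (hK y)).restrict.congr (.of_forall fun t ↦ ?_)
      simp only [Pi.sub_apply]
      ring
  have htail : Tendsto (fun R : ℝ ↦ ∫ v in Icc (-R) R, fejerKernel v) atTop (𝓝 I) :=
    (aecover_Icc tendsto_neg_atTop_atBot tendsto_id).integral_tendsto_of_countably_generated
      integrable_fejerKernel
  -- The Tauberian condition: over a window of length `2δ`, `b` cannot fall by more than a factor
  -- `e^(2δ)`.
  have hexp {s t : ℝ} (hst : s ≤ t) : b s ≤ b t * Real.exp (t - s) := by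
    have := hmono hst
    simp only at this
    rw [Real.exp_sub, ← mul_div_assoc, le_div_iff₀ (Real.exp_pos s)]
    exact this
  have hbounds {δ : ℝ} (hδ : 0 < δ) (hδI : δ < I) : ∀ᶠ y in atTop,
      b y ≤ Real.exp (2 * δ) * (I + δ) / (I - δ) ∧
      Real.exp (-(2 * δ)) * (I - δ - C * δ) / I ≤ b y := by
    -- Outside `[-R, R]` the kernel has mass less than `δ`; the scale `c = R / δ` turns `|v| ≤ R`
    -- into a shift of at most `δ`.
    obtain ⟨R, hR₀, hR⟩ := ((eventually_gt_atTop 0).and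
      (htail.eventually_const_lt (show I - δ < I by linarith))).exists
    have hc : 0 < R / δ := div_pos hR₀ hδ
    have hv {v : ℝ} (hv : v ∈ Icc (-R) R) : -δ ≤ v / (R / δ) ∧ v / (R / δ) ≤ δ := by
      rw [le_div_iff₀ hc, div_le_iff₀ hc, neg_mul, mul_div_cancel₀ _ hδ.ne']
      exact hv
    have hsplit (y : ℝ) := integral_add_compl (measurableSet_Icc (a := -R) (b := R))
      (hint (R / δ) y)
    have hsplitK := integral_add_compl (measurableSet_Icc (a := -R) (b := R))
      integrable_fejerKernel
    have hup (y : ℝ) : b (y - δ) * Real.exp (-(2 * δ)) * (I - δ) ≤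
        ∫ v, b (y - v / (R / δ)) * fejerKernel v := by
      rw [← hsplit y]
      have h₁ : 0 ≤ ∫ v in (Icc (-R) R)ᶜ, b (y - v / (R / δ)) * fejerKernel v :=
        integral_nonneg fun v ↦ mul_nonneg (hnn _) (fejerKernel_nonneg v)
      have h₂ : b (y - δ) * Real.exp (-(2 * δ)) * ∫ v in Icc (-R) R, fejerKernel v ≤
          ∫ v in Icc (-R) R, b (y - v / (R / δ)) * fejerKernel v := by
        rw [← integral_const_mul]
        refine setIntegral_mono_on (integrable_fejerKernel.const_mul _).integrableOn
          (hint _ y).integrableOn measurableSet_Icc fun v hvm ↦ ?_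
        refine mul_le_mul_of_nonneg_right ?_ (fejerKernel_nonneg v)
        have h := hexp (show y - δ ≤ y - v / (R / δ) by linarith [(hv hvm).2])
        rw [Real.exp_neg, ← div_eq_mul_inv, div_le_iff₀ (Real.exp_pos _)]
        refine h.trans (mul_le_mul_of_nonneg_left (Real.exp_le_exp.mpr ?_) (hnn _))
        linarith [(hv hvm).1]
      have h₃ := mul_le_mul_of_nonneg_left hR.le
        (mul_nonneg (hnn (y - δ)) (Real.exp_nonneg (-(2 * δ))))
      linarith
    have hlow (y : ℝ) : ∫ v, b (y - v / (R / δ)) * fejerKernel v ≤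
        b (y + δ) * Real.exp (2 * δ) * I + C * δ := by
      rw [← hsplit y]
      have h₁ : ∫ v in (Icc (-R) R)ᶜ, b (y - v / (R / δ)) * fejerKernel v ≤ C * δ := by
        calc _ ≤ ∫ v in (Icc (-R) R)ᶜ, C * fejerKernel v :=
              integral_mono (hint _ y).restrict (integrable_fejerKernel.const_mul _).restrict
                fun v ↦ mul_le_mul_of_nonneg_right (hC _) (fejerKernel_nonneg v)
          _ = C * ∫ v in (Icc (-R) R)ᶜ, fejerKernel v := integral_const_mul _ _
          _ ≤ C * δ := mul_le_mul_of_nonneg_left (by linarith) hC₀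
      have h₂ : ∫ v in Icc (-R) R, b (y - v / (R / δ)) * fejerKernel v ≤
          b (y + δ) * Real.exp (2 * δ) * ∫ v in Icc (-R) R, fejerKernel v := by
        rw [← integral_const_mul]
        refine setIntegral_mono_on (hint _ y).integrableOn
          (integrable_fejerKernel.const_mul _).integrableOn measurableSet_Icc fun v hvm ↦ ?_
        refine mul_le_mul_of_nonneg_right ?_ (fejerKernel_nonneg v)
        refine (hexp (show y - v / (R / δ) ≤ y + δ by linarith [(hv hvm).1])).trans
          (mul_le_mul_of_nonneg_left (Real.exp_le_exp.mpr ?_) (hnn _))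
        linarith [(hv hvm).2]
      have h₃ : ∫ v in Icc (-R) R, fejerKernel v ≤ I :=
        setIntegral_le_integral integrable_fejerKernel (.of_forall fejerKernel_nonneg)
      have h₄ := mul_le_mul_of_nonneg_left h₃
        (mul_nonneg (hnn (y + δ)) (Real.exp_nonneg (2 * δ)))
      linarith
    have hlim := hconv hc
    have ev₁ := (tendsto_atTop_add_const_right atTop δ tendsto_id).eventually
      (hlim.eventually_lt_const (show I < I + δ by linarith))
    have ev₂ := (tendsto_atTop_add_const_right atTop (-δ) tendsto_id).eventually
      (hlim.eventually_const_lt (show I - δ < I by linarith))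
    filter_upwards [ev₁, ev₂] with y h₁ h₂
    simp only [id] at h₁ h₂
    -- Centring the window at `y + δ` or `y - δ` puts `y` at its left or right end.
    have u := (hup (y + δ)).trans h₁.le
    have l := h₂.le.trans (hlow (y + -δ))
    rw [add_sub_cancel_right] at u
    rw [neg_add_cancel_right] at l
    have hee : Real.exp (2 * δ) * Real.exp (-(2 * δ)) = 1 := by
      rw [← Real.exp_add, add_neg_cancel, Real.exp_zero]
    constructor
    · rw [le_div_iff₀ (by linarith)]
      calc b y * (I - δ) = Real.exp (2 * δ) * (b y * Real.exp (-(2 * δ)) * (I - δ)) := by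
            linear_combination (-b y * (I - δ)) * hee
        _ ≤ _ := mul_le_mul_of_nonneg_left u (Real.exp_nonneg _)
    · rw [div_le_iff₀ hI₀]
      calc _ ≤ Real.exp (-(2 * δ)) * (b y * Real.exp (2 * δ) * I) :=
            mul_le_mul_of_nonneg_left (by linarith) (Real.exp_nonneg _)
        _ = b y * I := by linear_combination (b y * I) * hee
  have hne : I - 0 ≠ 0 := by simpa using hI₀.ne'
  have hu : Tendsto (fun δ : ℝ ↦ Real.exp (2 * δ) * (I + δ) / (I - δ)) (𝓝[>] 0) (𝓝 1) := by
    have : ContinuousAt (fun δ : ℝ ↦ Real.exp (2 * δ) * (I + δ) / (I - δ)) 0 := by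
      fun_prop (disch := exact hne)
    have := this.tendsto.mono_left (nhdsWithin_le_nhds (s := Ioi 0))
    simpa [hI₀.ne'] using this
  have hl : Tendsto (fun δ : ℝ ↦ Real.exp (-(2 * δ)) * (I - δ - C * δ) / I) (𝓝[>] 0) (𝓝 1) := by
    have : Continuous (fun δ : ℝ ↦ Real.exp (-(2 * δ)) * (I - δ - C * δ) / I) := by fun_prop
    have := (this.tendsto 0).mono_left (nhdsWithin_le_nhds (s := Ioi 0))
    simpa [hI₀.ne'] using this
  have hpos : ∀ᶠ δ : ℝ in 𝓝[>] 0, 0 < δ ∧ δ < I := Ioo_mem_nhdsGT hI₀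
  refine tendsto_order.mpr ⟨fun m hm ↦ ?_, fun m hm ↦ ?_⟩
  · obtain ⟨δ, ⟨h₀, h₁⟩, h₂⟩ := (hpos.and (hl.eventually_const_lt hm)).exists
    filter_upwards [hbounds h₀ h₁] with y hy using h₂.trans_le hy.2
  · obtain ⟨δ, ⟨h₀, h₁⟩, h₂⟩ := (hpos.and (hu.eventually_lt_const hm)).exists
    filter_upwards [hbounds h₀ h₁] with y hy using hy.1.trans_lt h₂

/-! ### The Laplace transform of `ψ(e^t) e^(-t)` -/

lemma residueClass_one_eq_vonMangoldt :
    ArithmeticFunction.vonMangoldt.residueClass (1 : ZMod 1) =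
      fun n ↦ ArithmeticFunction.vonMangoldt n := by
  funext n
  have h : (n : ZMod 1) = 1 := Subsingleton.elim _ _
  simp [ArithmeticFunction.vonMangoldt.residueClass, h]

lemma sum_vonMangoldt_isBigO :
    (fun n : ℕ ↦ ∑ k ∈ Finset.Icc 1 n, ArithmeticFunction.vonMangoldt k) =O[atTop]
      fun n ↦ (n : ℝ) ^ (1 : ℝ) := by
  refine Asymptotics.IsBigO.of_bound (Real.log 4 + 4) (.of_forall fun n ↦ ?_)
  have h := Chebyshev.psi_le_const_mul_self (x := n) n.cast_nonneg
  have h₀ := Chebyshev.psi_nonneg n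
  rw [Chebyshev.psi, Nat.floor_natCast] at h h₀
  rw [Real.rpow_one, Real.norm_of_nonneg n.cast_nonneg]
  change ‖∑ k ∈ Finset.Ioc 0 n, ArithmeticFunction.vonMangoldt k‖ ≤ _
  rwa [Real.norm_of_nonneg h₀]

/-- Abel summation followed by the substitution `x = e^t`. -/
lemma LSeries_vonMangoldt_eq_mul_laplace {s : ℂ} (hs : 0 < s.re) :
    LSeries (fun n ↦ (ArithmeticFunction.vonMangoldt n : ℂ)) (1 + s) = (1 + s) *
      ∫ t in Ioi (0 : ℝ), ((Chebyshev.psi (Real.exp t) * Real.exp (-t) : ℝ) : ℂ) *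
        Complex.exp (-s * t) := by
  rw [LSeries_eq_mul_integral_of_nonneg _ zero_le_one (by simpa using hs) sum_vonMangoldt_isBigO
    fun _ ↦ ArithmeticFunction.vonMangoldt_nonneg]
  congr 1
  have himg : Real.exp '' Ioi 0 = Ioi 1 := by
    ext x
    constructor
    · rintro ⟨t, ht, rfl⟩
      exact Real.one_lt_exp_iff.mpr ht
    · intro hx
      exact ⟨Real.log x, Real.log_pos hx, Real.exp_log (zero_lt_one.trans hx)⟩
  rw [← himg, integral_image_eq_integral_abs_deriv_smul measurableSet_Ioi
    (fun t _ ↦ (Real.hasDerivAt_exp t).hasDerivWithinAt) Real.exp_injective.injOn]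
  refine integral_congr_ae (.of_forall fun t ↦ ?_)
  have hψ : (∑ k ∈ Finset.Icc 1 ⌊Real.exp t⌋₊, (ArithmeticFunction.vonMangoldt k : ℂ)) =
      (Chebyshev.psi (Real.exp t) : ℂ) := by
    rw [Chebyshev.psi, Complex.ofReal_sum]
    rfl
  simp only [abs_of_pos (Real.exp_pos t), Complex.real_smul]
  rw [hψ, Complex.cpow_def_of_ne_zero (by simp),
    ← Complex.ofReal_log (Real.exp_nonneg t), Real.log_exp]
  push_cast
  have : Complex.exp t * Complex.exp (t * -(1 + s + 1)) =
      Complex.exp (-t) * Complex.exp (-s * t) := by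
    rw [← Complex.exp_add, ← Complex.exp_add]
    congr 1
    ring
  linear_combination (Chebyshev.psi (Real.exp t) : ℂ) * this

/-- Modulus 1 has a single residue class, so the auxiliary function is `-ζ'/ζ` with its pole `1/s`
at `1 + s` removed; the transform of 1 is this same `1/s`. -/
theorem integral_psi_exp_sub_one_laplace {s : ℂ} (hs : 0 < s.re) :
    ∫ t in Ioi (0 : ℝ), ((Chebyshev.psi (Real.exp t) * Real.exp (-t) - 1 : ℝ) : ℂ) *
        Complex.exp (-s * t) =
      (ArithmeticFunction.vonMangoldt.LFunctionResidueClassAux (1 : ZMod 1) (1 + s) - 1) /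
        (1 + s) := by
  have hs₀ : s ≠ 0 := fun h ↦ by simp [h] at hs
  have hs₁ : 1 + s ≠ 0 := fun h ↦ by
    have := congrArg Complex.re h
    simp at this
    linarith
  have haux := ArithmeticFunction.vonMangoldt.eqOn_LFunctionResidueClassAux (q := 1) (a := 1)
    isUnit_one (show 1 < (1 + s).re by simpa using hs)
  simp only [residueClass_one_eq_vonMangoldt, Nat.totient_one, Nat.cast_one, inv_one,
    add_sub_cancel_left] at haux
  rw [LSeries_vonMangoldt_eq_mul_laplace hs] at haux
  have hexp : ∫ t in Ioi (0 : ℝ), Complex.exp (-s * t) = 1 / s := by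
    rw [integral_exp_mul_complex_Ioi (by simpa using hs)]
    simp
  have hi : IntegrableOn (fun t : ℝ ↦ Complex.exp (-s * t)) (Ioi 0) :=
    integrableOn_exp_mul_complex_Ioi (by simpa using hs) 0
  have hψi : IntegrableOn (fun t : ℝ ↦ ((Chebyshev.psi (Real.exp t) * Real.exp (-t) : ℝ) : ℂ) *
      Complex.exp (-s * t)) (Ioi 0) := by
    refine hi.bdd_mul (c := Real.log 4 + 4) ?_ (.of_forall fun t ↦ ?_)
    · have := Chebyshev.psi_mono.measurable
      exact Measurable.aestronglyMeasurable (by fun_prop)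
    · rw [Complex.norm_real, Real.norm_of_nonneg
        (mul_nonneg (Chebyshev.psi_nonneg _) (Real.exp_nonneg _)), Real.exp_neg,
        ← div_eq_mul_inv, div_le_iff₀ (Real.exp_pos t)]
      exact Chebyshev.psi_le_const_mul_self (Real.exp_nonneg t)
  simp only [Complex.ofReal_sub, Complex.ofReal_one, sub_mul, one_mul]
  rw [integral_sub hψi hi, hexp, haux]
  field_simp
  ring

/-! ### The prime number theorem for `ψ`, `θ` and `p_n` -/

lemma tendsto_psi_exp_mul_exp_neg :
    Tendsto (fun t : ℝ ↦ Chebyshev.psi (Real.exp t) * Real.exp (-t)) atTop (𝓝 1) := by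
  refine tendsto_one_of_laplace (C := Real.log 4 + 4)
    (G := fun s ↦ (ArithmeticFunction.vonMangoldt.LFunctionResidueClassAux (1 : ZMod 1) (1 + s)
      - 1) / (1 + s)) ?_ (fun t ht ↦ ?_)
    (fun t ↦ mul_nonneg (Chebyshev.psi_nonneg _) (Real.exp_nonneg _)) (fun t ↦ ?_) ?_ ?_
    fun s hs ↦ integral_psi_exp_sub_one_laplace hs
  · have := Chebyshev.psi_mono.measurable
    fun_prop
  · rw [Chebyshev.psi_eq_zero_of_le_one (Real.exp_le_one_iff.mpr ht), zero_mul]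
  · rw [Real.exp_neg, ← div_eq_mul_inv, div_le_iff₀ (Real.exp_pos t)]
    exact Chebyshev.psi_le_const_mul_self (Real.exp_nonneg t)
  · intro s t hst
    simp only [mul_assoc, ← Real.exp_add, neg_add_cancel, Real.exp_zero, mul_one]
    exact Chebyshev.psi_mono (Real.exp_le_exp.mpr hst)
  · refine ContinuousOn.div (ContinuousOn.sub ?_ continuousOn_const) (by fun_prop) fun s hs h ↦ ?_
    -- The non-vanishing of `ζ` on `Re s = 1` enters here.
    · exact (ArithmeticFunction.vonMangoldt.continuousOn_LFunctionResidueClassAux 1).comp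
        (by fun_prop) fun s hs ↦ by simpa using hs
    · have := congrArg Complex.re h
      simp only [Complex.add_re, Complex.one_re, Complex.zero_re] at this
      have hs' : 0 ≤ s.re := hs
      linarith

/-- The **prime number theorem** for the second Chebyshev function. -/
theorem psi_isEquivalent_id : Asymptotics.IsEquivalent atTop Chebyshev.psi id := by
  refine (Asymptotics.isEquivalent_iff_tendsto_one (eventually_ne_atTop 0)).mpr ?_
  refine (tendsto_psi_exp_mul_exp_neg.comp Real.tendsto_log_atTop).congr' ?_
  filter_upwards [eventually_gt_atTop 0] with x hx
  simp [Real.exp_neg, Real.exp_log hx, div_eq_mul_inv]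

/-- The **prime number theorem** for the first Chebyshev function. -/
theorem theta_isEquivalent_id : Asymptotics.IsEquivalent atTop Chebyshev.theta id := by
  have hsqrt : Real.sqrt =o[atTop] (id : ℝ → ℝ) := by
    refine Asymptotics.isLittleO_of_tendsto' ?_ ?_
    · filter_upwards [eventually_ne_atTop 0] with x hx h using absurd h hx
    · exact (tendsto_inv_atTop_zero.comp Real.tendsto_sqrt_atTop).congr fun x ↦
        Real.sqrt_div_self.symm
  have := psi_isEquivalent_id.sub_isLittleO
    (Chebyshev.isBigO_psi_sub_theta_sqrt.trans_isLittleO hsqrt)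
  simpa using this

lemma tendsto_nthPrime_atTop : Tendsto nthPrime atTop atTop :=
  (Nat.nth_strictMono Nat.infinite_setOfPred_prime).tendsto_atTop.comp (tendsto_sub_atTop_nat 1)

theorem theorem2 :
    Asymptotics.IsEquivalent Filter.atTop
      (fun n : ℕ => Chebyshev.theta (nthPrime n : ℝ))
      (fun n : ℕ => (nthPrime n : ℝ)) :=
  theta_isEquivalent_id.comp_tendsto (tendsto_natCast_atTop_atTop.comp tendsto_nthPrime_atTop)
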